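/- All Hilbert spaces are finite-dimensional and input spaces are non-zero; a channel is a completely positive trace-preserving linear map, and a state is a positive operator of trace at most $1$. Let $$\Lambda:\mathcal L\Big(\bigotimes_{k=1}^N\mathcal H^{k}_{in}\Big)\to\mathcal L\Big(\bigotimes_{k=1}^N\mathcal H^{k}_{out}\Big)$$ be an $N$-partite channel with parties $A_1,\dots,A_N$. For a bipartition $S_A\sqcup S_B=\{1,\dots,N\}$ write $S_B\not\to S_A$ (semicausality from $S_B$ to $S_A$) if there is a channel $\Gamma:\mathcal L(\mathcal H^{S_A}_{in})\to\mathcal L(\mathcal H^{S_A}_{out})$ with $\mathrm{tr}_{S_B}\{\Lambda[\rho]\}=\Gamma(\mathrm{tr}_{S_B}[\rho])$ for all states $\rho$ on $\bigotimes_k\mathcal H^k_{in}$. Assume $A_N\not\to\cdots\not\to A_2\not\to A_1$, that is, $\{k+1,\dots,N\}\not\to\{1,\dots,k\}$ for every $1\le k<N$. Then there exist finite-dimensional Hilbert spaces $\mathcal H^E_0,\mathcal H^E_1,\dots,\mathcal H^E_N$ (the initial, intermediate and final spaces of an ancilla $E$), a unit vector $|0\rangle\in\mathcal H^E_0$, and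 unitary operators $$U_{A_kE}:\mathcal H^{k}_{in}\otimes\mathcal H^{E}_{k-1}\to\mathcal H^{k}_{out}\otimes\mathcal H^{E}_{k}\qquad(1\le k\le N)$$ such that, for every operator $\rho$ on $\bigotimes_k\mathcal H^k_{in}$ (in particular for every state), $$\Lambda[\rho]=\mathrm{tr}_E\big\{U\,(\rho\otimes|0\rangle\langle 0|_E)\,U^\dagger\big\},\qquad U=U_{A_NE}\cdots U_{A_2E}\,U_{A_1E},$$ where each factor $U_{A_kE}$ acts as the identity on all parties other than $A_k$, and $\mathrm{tr}_E$ is the partial trace over $\mathcal H^E_N$. -/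

import Mathlib

open scoped Kronecker ComplexOrder

/-! A finite-dimensional Hilbert space with a fixed orthonormal basis labelled by a finite type `a`
is written through its label type: operators are complex matrices indexed by `a`, and the
(tensor) product of the spaces labelled by `m i` has its basis labelled by `∀ i, m i`. -/

/-- A (possibly subnormalised) state: a positive operator with trace at most `1`. -/
def IsState {a : Type*} [Fintype a] (ρ : Matrix a a ℂ) : Prop :=
  ρ.PosSemidef ∧ ρ.trace ≤ 1

/-- The amplification `id ⊗ Φ` on `L(ℂʳ ⊗ H)`. -/
def amplify {a b : Type*} (Φ : Matrix a a ℂ →ₗ[ℂ] Matrix b b ℂ) (r : ℕ)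
    (X : Matrix (Fin r × a) (Fin r × a) ℂ) : Matrix (Fin r × b) (Fin r × b) ℂ :=
  Matrix.of fun p q => Φ (Matrix.of fun x y => X (p.1, x) (q.1, y)) p.2 q.2

/-- Complete positivity: every amplification preserves positive semidefiniteness. -/
def IsCompletelyPositive {a b : Type*} [Fintype a] [Fintype b]
    (Φ : Matrix a a ℂ →ₗ[ℂ] Matrix b b ℂ) : Prop :=
  ∀ (r : ℕ) (X : Matrix (Fin r × a) (Fin r × a) ℂ), X.PosSemidef → (amplify Φ r X).PosSemidef

/-- A quantum channel: a completely positive trace-preserving linear map. -/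
def IsChannel {a b : Type*} [Fintype a] [Fintype b]
    (Φ : Matrix a a ℂ →ₗ[ℂ] Matrix b b ℂ) : Prop :=
  IsCompletelyPositive Φ ∧ ∀ X : Matrix a a ℂ, (Φ X).trace = X.trace

/-- The reduced operator on the parties in `S`: the partial trace over all parties outside `S`. -/
def reduce {ι : Type*} [Fintype ι] [DecidableEq ι] {m : ι → Type*} [∀ i, Fintype (m i)]
    (S : Finset ι) (X : Matrix (∀ i, m i) (∀ i, m i) ℂ) :
    Matrix (∀ i : {i // i ∈ S}, m i) (∀ i : {i // i ∈ S}, m i) ℂ :=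
  Matrix.of fun x y => ∑ z : (∀ i : {i // ¬ i ∈ S}, m i),
    X ((Equiv.piEquivPiSubtypeProd (· ∈ S) m).symm (x, z))
      ((Equiv.piEquivPiSubtypeProd (· ∈ S) m).symm (y, z))

/-- `Sᶜ ↛ S`: the reduced output state of the parties in `S` is obtained by a channel from the
reduced input state of the parties in `S`. -/
def IsSemicausal {ι : Type*} [Fintype ι] [DecidableEq ι] {m n : ι → Type*}
    [∀ i, Fintype (m i)] [∀ i, Fintype (n i)]
    (Φ : Matrix (∀ i, m i) (∀ i, m i) ℂ →ₗ[ℂ] Matrix (∀ i, n i) (∀ i, n i) ℂ)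
    (S : Finset ι) : Prop :=
  ∃ Γ : Matrix (∀ i : {i // i ∈ S}, m i) (∀ i : {i // i ∈ S}, m i) ℂ →ₗ[ℂ]
      Matrix (∀ i : {i // i ∈ S}, n i) (∀ i : {i // i ∈ S}, n i) ℂ,
    IsChannel Γ ∧ ∀ ρ, IsState ρ → reduce S (Φ ρ) = Γ (reduce S ρ)

/-- `A_N ↛ … ↛ A_2 ↛ A_1`: for every cut `1 ≤ k < N` the last `N - k` parties do not signal to the
first `k` parties. -/
def IsOrderedSemicausal {N : ℕ} {m n : Fin N → Type*}
    [∀ k, Fintype (m k)] [∀ k, Fintype (n k)]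
    (Φ : Matrix (∀ k, m k) (∀ k, m k) ℂ →ₗ[ℂ] Matrix (∀ k, n k) (∀ k, n k) ℂ) : Prop :=
  ∀ k : ℕ, 1 ≤ k → k < N →
    IsSemicausal Φ (Finset.univ.filter fun i : Fin N => (i : ℕ) < k)

/-- A unitary operator between (a priori different) spaces. -/
def IsUnitaryOp {a b : Type*} [Fintype a] [DecidableEq a] [Fintype b] [DecidableEq b]
    (U : Matrix b a ℂ) : Prop :=
  U.conjTranspose * U = 1 ∧ U * U.conjTranspose = 1

/-- The sequential composition `U_{A_N E} ⋯ U_{A_2 E} U_{A_1 E}`, where the ancilla `E` has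
dimension `e k` after the first `k` factors and each factor acts as the identity on all parties
but its own. The parties are numbered from `0`, and party `k` has factor `U k`. In the recursive
step the product of the first `N` factors is tensored with the identity on the input of the last
party, and is followed by the factor of the last party tensored with the identity on the outputs
of the others. -/
noncomputable def sequentialOp : (N : ℕ) → (m : Fin N → Type*) → (n : Fin N → Type*) →
    [∀ k, Fintype (m k)] → [∀ k, DecidableEq (m k)] →
    [∀ k, Fintype (n k)] → [∀ k, DecidableEq (n k)] → (e : ℕ → ℕ) →
    (∀ k : Fin N, Matrix (n k × Fin (e (k + 1))) (m k × Fin (e k)) ℂ) →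
    Matrix ((∀ k, n k) × Fin (e N)) ((∀ k, m k) × Fin (e 0)) ℂ
  | 0, _, _, _, _, _, _, _, _ => (1 : Matrix _ _ ℂ).submatrix Prod.snd Prod.snd
  | N + 1, m, n, _, _, _, _, e, U =>
    let W : Matrix ((∀ k : Fin N, n k.castSucc) × Fin (e N))
        ((∀ k : Fin N, m k.castSucc) × Fin (e 0)) ℂ :=
      sequentialOp N (fun k => m k.castSucc) (fun k => n k.castSucc) e fun k => U k.castSucc
    let first : Matrix ((∀ k : Fin N, n k.castSucc) × (m (Fin.last N) × Fin (e N)))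
        ((∀ k, m k) × Fin (e 0)) ℂ :=
      (W ⊗ₖ (1 : Matrix (m (Fin.last N)) (m (Fin.last N)) ℂ)).submatrix
        (fun p => ((p.1, p.2.2), p.2.1)) (fun q => ((Fin.init q.1, q.2), q.1 (Fin.last N)))
    let last : Matrix ((∀ k, n k) × Fin (e (N + 1)))
        ((∀ k : Fin N, n k.castSucc) × (m (Fin.last N) × Fin (e N))) ℂ :=
      ((1 : Matrix (∀ k : Fin N, n k.castSucc) (∀ k : Fin N, n k.castSucc) ℂ) ⊗ₖ
          U (Fin.last N)).submatrix
        (fun p => (Fin.init p.1, (p.1 (Fin.last N), p.2))) id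
    last * first

/-- The partial trace `tr_E` over the second tensor factor. -/
def traceAncilla {a c : Type*} [Fintype c] (X : Matrix (a × c) (a × c) ℂ) : Matrix a a ℂ :=
  Matrix.of fun x y => ∑ f, X (x, f) (y, f)

/-- The rank-one projector `|ψ⟩⟨ψ|`. -/
def ketbra {c : Type*} (ψ : EuclideanSpace ℂ c) : Matrix c c ℂ :=
  Matrix.vecMulVec (fun i => ψ i) (fun i => star (ψ i))

/-! Induction on the number of parties, driven by the uniqueness of Stinespring dilations. Fixing
the input of the last party and tracing out its output leaves a trace-preserving map with the same
ordered non-signalling structure; by induction it has a sequential dilation `w`. Since the last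
party does not signal, `w` tensored with the identity on the last input dilates `traceLast ∘ Φ`
(`IsNonsignalling.dropLast_traceLast`). The Kraus operators of `Φ` give a second dilation of that
map, whose environment is the last output together with the ancilla. Both dilations have the same
Gram matrix, so a unitary between the environments relates them (`exists_unitary_mul_eq`); it is the
last factor.

Unitarity needs `card (m k) * e k = card (n k) * e (k + 1)` at every step, with ancillas large
enough to hold all Kraus labels. `exists_balanced_sequence` provides such dimensions. -/

/-! ### Unitary freedom for equal Gram matrices. -/

open Matrix in
/-- Matrices with the same Gram matrix and equally many rows differ by a unitary. -/
theorem exists_unitary_mul_eq {k k' l : Type*} [Fintype k] [DecidableEq k] [Fintype k']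
    [DecidableEq k'] [Fintype l] [DecidableEq l] (X : Matrix k l ℂ) (Y : Matrix k' l ℂ)
    (hcard : Fintype.card k = Fintype.card k')
    (h : X.conjTranspose * X = Y.conjTranspose * Y) :
    ∃ Q : Matrix k' k ℂ, IsUnitaryOp Q ∧ Q * X = Y := by
  obtain ⟨σ⟩ : Nonempty (k ≃ k') := Fintype.card_eq.mp hcard
  let Y' : Matrix k l ℂ := Y.submatrix σ id
  have hY' : X.conjTranspose * X = Y'.conjTranspose * Y' := by
    rw [h]
    ext i j
    simp only [Matrix.mul_apply, Y', Matrix.conjTranspose_apply, Matrix.submatrix_apply, id]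
    exact (Equiv.sum_comp σ fun t => star (Y t i) * Y t j).symm
  let x := Matrix.toEuclideanLin X
  let y := Matrix.toEuclideanLin Y'
  have hnorm : ∀ v, ‖y v‖ = ‖x v‖ := by
    have key : ∀ (Z : Matrix k l ℂ) v, inner ℂ (Matrix.toEuclideanLin Z v)
        (Matrix.toEuclideanLin Z v)
        = ((Z.conjTranspose * Z) *ᵥ v.ofLp) ⬝ᵥ star v.ofLp := by
      intro Z v
      rw [EuclideanSpace.inner_eq_star_dotProduct]
      simp only [Matrix.toEuclideanLin, Matrix.toLpLin_apply]
      rw [Matrix.star_mulVec, dotProduct_comm, ← Matrix.dotProduct_mulVec, Matrix.mulVec_mulVec,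
        dotProduct_comm]
    intro v
    have h1 : inner ℂ (y v) (y v) = inner ℂ (x v) (x v) := by
      simp only [x, y, key, hY']
    rw [inner_self_eq_norm_sq_to_K, inner_self_eq_norm_sq_to_K] at h1
    have h2 : ‖y v‖ ^ 2 = ‖x v‖ ^ 2 := by exact_mod_cast h1
    exact (sq_eq_sq₀ (norm_nonneg _) (norm_nonneg _)).mp h2
  have hker : LinearMap.ker x ≤ LinearMap.ker y := by
    intro v hv
    rw [LinearMap.mem_ker] at hv ⊢
    rw [← norm_eq_zero, hnorm, hv, norm_zero]
  -- By `hker`, `x v ↦ y v` is well defined on the range of `x`; by `hnorm` it is isometric there,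
  -- so it extends to an isometry of the whole space.
  let g : LinearMap.range x →ₗ[ℂ] EuclideanSpace ℂ k :=
    ((LinearMap.ker x).liftQ y hker) ∘ₗ x.quotKerEquivRange.symm.toLinearMap
  have hg : ∀ v, g ⟨x v, LinearMap.mem_range_self x v⟩ = y v := by
    intro v
    simp only [g, LinearMap.comp_apply, LinearEquiv.coe_coe]
    rw [LinearMap.quotKerEquivRange_symm_apply_image x v]
    simp
  let G : LinearMap.range x →ₗᵢ[ℂ] EuclideanSpace ℂ k :=
    { g with
      norm_map' := by
        rintro ⟨_, v, rfl⟩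
        exact (congrArg norm (hg v)).trans (hnorm v) }
  let T := G.extend
  have hT : ∀ v, T (x v) = y v := fun v =>
    (LinearIsometry.extend_apply G ⟨x v, LinearMap.mem_range_self x v⟩).trans (hg v)
  let M : Matrix k k ℂ := (Matrix.toEuclideanCLM (𝕜 := ℂ) (n := k)).symm T.toContinuousLinearMap
  have hM : Matrix.toEuclideanCLM (𝕜 := ℂ) (n := k) M = T.toContinuousLinearMap := by simp [M]
  have hMM : M.conjTranspose * M = 1 := by
    apply (EquivLike.injective (Matrix.toEuclideanCLM (𝕜 := ℂ) (n := k)))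
    rw [← Matrix.star_eq_conjTranspose, map_mul, map_star, hM, map_one,
      ContinuousLinearMap.star_eq_adjoint]
    exact T.adjoint_comp_self
  have hMX : M * X = Y' := by
    apply (Matrix.toEuclideanLin (𝕜 := ℂ)).injective
    ext1 v
    rw [← hT v, ← T.coe_toContinuousLinearMap, ← hM]
    simp only [Matrix.toEuclideanLin, Matrix.toLpLin_apply, x, ← Matrix.mulVec_mulVec]
    rfl
  have hQ : (M.submatrix σ.symm id).conjTranspose * M.submatrix σ.symm id = 1 := by
    rw [← hMM]
    ext i j
    simp only [Matrix.mul_apply, Matrix.conjTranspose_apply, Matrix.submatrix_apply, id]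
    exact Equiv.sum_comp σ.symm fun t => star (M t i) * M t j
  refine ⟨M.submatrix σ.symm id, ⟨hQ, ?_⟩, ?_⟩
  · exact (Matrix.mul_eq_one_comm_of_card_eq k k' ℂ hcard).mp hQ
  · ext i j
    have := congrFun (congrFun hMX (σ.symm i)) j
    simpa [Matrix.mul_apply, Y'] using this

/-! ### Kraus operators, and extension of linear identities from states. -/

/-- `K` is a family of Kraus operators of `Φ`. -/
def HasKraus {t a b : Type*} [Fintype t] [Fintype a]
    (Φ : Matrix a a ℂ →ₗ[ℂ] Matrix b b ℂ) (K : t → Matrix b a ℂ) : Prop :=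
  ∀ X x y, Φ X x y = ∑ f, ∑ i, ∑ j, K f x i * X i j * star (K f y j)

open scoped MatrixOrder Matrix.Norms.L2Operator in
theorem Matrix.PosSemidef.exists_eq_conjTranspose_mul_self {k : Type*} [Fintype k] [DecidableEq k]
    {A : Matrix k k ℂ} (hA : A.PosSemidef) : ∃ B : Matrix k k ℂ, A = B.conjTranspose * B :=
  CStarAlgebra.nonneg_iff_eq_star_mul_self.mp hA.nonneg

theorem IsCompletelyPositive.exists_hasKraus {a b : Type*} [Fintype a] [Fintype b]
    [DecidableEq a] [DecidableEq b] {Φ : Matrix a a ℂ →ₗ[ℂ] Matrix b b ℂ}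
    (h : IsCompletelyPositive Φ) :
    ∃ K : Fin (Fintype.card a) × b → Matrix b a ℂ, HasKraus Φ K := by
  let e := Fintype.equivFin a
  -- The unnormalised maximally entangled vector: amplifying `Φ` on its projector gives the Choi
  -- matrix, and the conjugated rows of a factor `B` are the Kraus operators.
  let u : Fin (Fintype.card a) × a → ℂ := fun p => if e.symm p.1 = p.2 then 1 else 0
  have hC := h _ _ (Matrix.posSemidef_vecMulVec_self_star u)
  obtain ⟨B, hB⟩ := hC.exists_eq_conjTranspose_mul_self
  have hsingle : ∀ i j x y, Φ (Matrix.single i j 1) x y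
      = ∑ f, star (B f (e i, x)) * B f (e j, y) := by
    intro i j x y
    have h1 := congrFun (congrFun hB (e i, x)) (e j, y)
    rw [Matrix.mul_apply] at h1
    simp only [Matrix.conjTranspose_apply] at h1
    rw [← h1]
    simp only [amplify, Matrix.of_apply]
    refine congrFun (congrFun (congrArg Φ ?_) x) y
    ext p q
    simp [u, Matrix.vecMulVec_apply, Matrix.single_apply, ite_and]
    split_ifs <;> rfl
  refine ⟨fun f => Matrix.of fun x i => star (B f (e i, x)), fun X x y => ?_⟩
  conv_lhs => rw [Matrix.matrix_eq_sum_single X]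
  have h2 : ∀ i j, Matrix.single i j (X i j) = X i j • Matrix.single i j (1 : ℂ) := by
    intro i j; simp
  simp only [map_sum, Matrix.sum_apply, h2, map_smul, Matrix.smul_apply, hsingle, smul_eq_mul,
    Finset.mul_sum, Matrix.of_apply, star_star]
  rw [Finset.sum_comm' (t' := Finset.univ) (s' := fun _ => Finset.univ) (by simp)]
  conv_rhs => rw [Finset.sum_comm]
  rw [Finset.sum_comm]
  refine Finset.sum_congr rfl fun i _ => ?_
  rw [Finset.sum_comm]
  refine Finset.sum_congr rfl fun j _ => Finset.sum_congr rfl fun f _ => ?_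
  ring

/-- A family of Kraus operators can be padded by zeros. -/
theorem HasKraus.exists_fin {t a b : Type*} [Fintype t] [Fintype a]
    {Φ : Matrix a a ℂ →ₗ[ℂ] Matrix b b ℂ} {K : t → Matrix b a ℂ} (h : HasKraus Φ K)
    {r : ℕ} (hr : Fintype.card t ≤ r) : ∃ K' : Fin r → Matrix b a ℂ, HasKraus Φ K' := by
  classical
  obtain ⟨s⟩ : Nonempty (t ↪ Fin r) :=
    Function.Embedding.nonempty_of_card_le (by simpa using hr)
  refine ⟨Function.extend s K 0, fun X x y => ?_⟩
  rw [h X x y]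
  have h0 : ∀ f, f ∉ Finset.univ.map s → ∑ i, ∑ j, Function.extend s K 0 f x i * X i j *
      star (Function.extend s K 0 f y j) = 0 := by
    intro f hf
    rw [Function.extend_apply' _ _ _ (by simpa using hf)]
    simp
  rw [← Finset.sum_subset (Finset.subset_univ (Finset.univ.map s)) fun f _ hf => h0 f hf,
    Finset.sum_map]
  simp only [s.injective.extend_apply]

/-- States span all matrices: rescaling reaches every positive operator, and polarisation every
rank-one matrix. -/
theorem LinearMap.ext_of_isState {a V : Type*} [Fintype a] [DecidableEq a] [AddCommGroup V]
    [Module ℂ V] {f g : Matrix a a ℂ →ₗ[ℂ] V} (h : ∀ ρ, IsState ρ → f ρ = g ρ) : f = g := by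
  have hpos : ∀ ρ : Matrix a a ℂ, ρ.PosSemidef → f ρ = g ρ := by
    intro ρ hρ
    obtain ⟨t, ht, htr⟩ : ∃ t : ℝ, 0 ≤ t ∧ ρ.trace = t := by
      have h0 := hρ.trace_nonneg
      rw [Complex.nonneg_iff] at h0
      exact ⟨ρ.trace.re, h0.1, Complex.ext rfl (by simp [← h0.2])⟩
    -- Dividing by `1 + t` instead of `t` also covers trace zero.
    have hc : (0 : ℝ) < (1 + t)⁻¹ := by positivity
    have hs : IsState ((((1 + t)⁻¹ : ℝ) : ℂ) • ρ) := by
      refine ⟨hρ.smul (by exact_mod_cast hc.le), ?_⟩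
      rw [Matrix.trace_smul, htr, smul_eq_mul, ← Complex.ofReal_mul]
      have : (1 + t)⁻¹ * t ≤ 1 := by
        rw [inv_mul_le_iff₀ (by positivity)]; linarith
      exact_mod_cast this
    have h1 := h _ hs
    rw [map_smul, map_smul] at h1
    exact smul_right_injective V (by exact_mod_cast hc.ne') h1
  have hP : ∀ u : a → ℂ, f (Matrix.vecMulVec u (star u)) = g (Matrix.vecMulVec u (star u)) :=
    fun u => hpos _ (Matrix.posSemidef_vecMulVec_self_star u)
  have hpol : ∀ u v : a → ℂ, (2 : ℂ) • Matrix.vecMulVec u (star v) =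
      Matrix.vecMulVec (u + v) (star (u + v))
      + Complex.I • Matrix.vecMulVec (u + Complex.I • v) (star (u + Complex.I • v))
      - (1 + Complex.I) • (Matrix.vecMulVec u (star u) + Matrix.vecMulVec v (star v)) := by
    intro u v
    ext i j
    simp only [Matrix.smul_apply, Matrix.add_apply, Matrix.sub_apply, Matrix.vecMulVec_apply,
      Pi.add_apply, Pi.smul_apply, Pi.star_apply, smul_eq_mul, star_add, star_mul,
      RCLike.star_def, Complex.conj_I]
    linear_combination (Complex.I * v i * (starRingEnd ℂ) (v j)
      + u i * (starRingEnd ℂ) (v j) - v i * (starRingEnd ℂ) (u j)) * Complex.I_mul_I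
  have hvec : ∀ u v : a → ℂ, f (Matrix.vecMulVec u (star v)) = g (Matrix.vecMulVec u (star v)) := by
    intro u v
    apply smul_right_injective V (two_ne_zero (α := ℂ))
    simp only [← map_smul, hpol]
    simp only [map_sub, map_add, map_smul, hP]
  ext X
  rw [Matrix.matrix_eq_sum_single X, map_sum, map_sum]
  refine Finset.sum_congr rfl fun i _ => ?_
  rw [map_sum, map_sum]
  refine Finset.sum_congr rfl fun j _ => ?_
  have : Matrix.single i j (X i j) = Matrix.vecMulVec (Pi.single i (X i j))
      (star (Pi.single j (1 : ℂ))) := by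
    ext p q
    simp [Matrix.single_apply, Matrix.vecMulVec_apply, Pi.single_apply, ite_and, eq_comm]
    split_ifs <;> rfl
  rw [this, hvec]

/-! ### Partial traces and non-signalling as a kernel condition. -/

section Reduce
variable {ι : Type*} [Fintype ι] [DecidableEq ι] {m : ι → Type*} [∀ i, Fintype (m i)]

/-- The partial trace over the parties outside `S`, with entries labelled by full labels. -/
def marginal [∀ i, DecidableEq (m i)] (S : Finset ι) (X : Matrix (∀ i, m i) (∀ i, m i) ℂ)
    (x y : ∀ i, m i) : ℂ :=
  ∑ u, ∑ v, if (∀ i ∈ S, u i = x i) ∧ (∀ i ∈ S, v i = y i) ∧ (∀ i ∉ S, u i = v i)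
    then X u v else 0

/-- Full labels avoid functions on subtypes, so cuts of `N + 1` and of `N` parties can be compared
directly. -/
theorem marginal_eq_reduce [∀ i, DecidableEq (m i)] (S : Finset ι)
    (X : Matrix (∀ i, m i) (∀ i, m i) ℂ) (x y : ∀ i, m i) :
    marginal S X x y =
      reduce S X (fun i : {i // i ∈ S} => x i) (fun i : {i // i ∈ S} => y i) := by
  let E := Equiv.piEquivPiSubtypeProd (· ∈ S) m
  have hc : ∀ p q : (∀ i : {i // i ∈ S}, m i) × (∀ i : {i // ¬ i ∈ S}, m i),
      ((∀ i ∈ S, E.symm p i = x i) ∧ (∀ i ∈ S, E.symm q i = y i) ∧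
        (∀ i ∉ S, E.symm p i = E.symm q i)) ↔
      (p.1 = (fun i : {i // i ∈ S} => x i) ∧ q.1 = (fun i : {i // i ∈ S} => y i) ∧ p.2 = q.2) := by
    intro p q
    refine and_congr ?_ (and_congr ?_ ?_)
    · rw [funext_iff, Subtype.forall]
      refine forall₂_congr fun i hi => ?_
      simp [E, Equiv.piEquivPiSubtypeProd, hi]
    · rw [funext_iff, Subtype.forall]
      refine forall₂_congr fun i hi => ?_
      simp [E, Equiv.piEquivPiSubtypeProd, hi]
    · rw [funext_iff, Subtype.forall]
      refine forall₂_congr fun i hi => ?_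
      simp [E, Equiv.piEquivPiSubtypeProd, hi]
  refine ((Equiv.sum_comp E.symm _).symm.trans
    (Finset.sum_congr rfl fun p _ => (Equiv.sum_comp E.symm _).symm)).trans ?_
  simp_rw [hc, Fintype.sum_prod_type, ite_and]
  rw [Finset.sum_eq_single (fun i : {i // i ∈ S} => x i) (by
    intro p _ hp; simp [hp]) (by simp)]
  simp only [if_true, reduce, Matrix.of_apply]
  refine Finset.sum_congr rfl fun z _ => ?_
  rw [Finset.sum_eq_single (fun i : {i // i ∈ S} => y i) (by
    intro p _ hp; simp [hp]) (by simp)]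
  simp [E]

theorem reduce_eq_zero_iff [∀ i, DecidableEq (m i)] [∀ i, Nonempty (m i)] (S : Finset ι)
    (X : Matrix (∀ i, m i) (∀ i, m i) ℂ) :
    reduce S X = 0 ↔ ∀ x y, marginal S X x y = 0 := by
  constructor
  · intro h x y
    rw [marginal_eq_reduce, h, Matrix.zero_apply]
  · intro h
    ext p q
    have hext : ∀ p : (∀ i : {i // i ∈ S}, m i), ∃ x : ∀ i, m i, (fun i : {i // i ∈ S} => x i) = p := by
      intro p
      refine ⟨fun i => if hi : i ∈ S then p ⟨i, hi⟩ else Classical.arbitrary _, ?_⟩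
      ext i
      simp
    obtain ⟨x, rfl⟩ := hext p
    obtain ⟨y, rfl⟩ := hext q
    rw [← marginal_eq_reduce, h, Matrix.zero_apply]

/-- `reduce S` as a linear map. -/
def reduceLinear (S : Finset ι) : Matrix (∀ i, m i) (∀ i, m i) ℂ →ₗ[ℂ]
    Matrix (∀ i : {i // i ∈ S}, m i) (∀ i : {i // i ∈ S}, m i) ℂ where
  toFun := reduce S
  map_add' X Y := by ext; simp [reduce, Finset.sum_add_distrib]
  map_smul' c X := by ext; simp [reduce, Finset.mul_sum]

theorem reduce_univ_eq_zero_iff [∀ i, DecidableEq (m i)] [∀ i, Nonempty (m i)] {S : Finset ι}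
    (hS : ∀ i, i ∈ S) (X : Matrix (∀ i, m i) (∀ i, m i) ℂ) : reduce S X = 0 ↔ X = 0 := by
  have h : ∀ x y, marginal S X x y = X x y := by
    intro x y
    simp [marginal, hS, ← funext_iff, ite_and]
  rw [reduce_eq_zero_iff]
  simp_rw [h]
  exact ⟨fun h => Matrix.ext h, fun h x y => by simp [h]⟩

theorem reduce_empty_eq_zero_iff [∀ i, DecidableEq (m i)] [∀ i, Nonempty (m i)]
    (X : Matrix (∀ i, m i) (∀ i, m i) ℂ) : reduce ∅ X = 0 ↔ X.trace = 0 := by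
  have h : ∀ x y, marginal ∅ X x y = X.trace := by
    intro x y
    simp [marginal, ← funext_iff, Matrix.trace]
  rw [reduce_eq_zero_iff]
  simp_rw [h]
  exact ⟨fun h => h (fun _ => Classical.arbitrary _) (fun _ => Classical.arbitrary _),
    fun h _ _ => h⟩

/-- Inputs indistinguishable on `S` have outputs indistinguishable on `S`. -/
def IsNonsignalling {n : ι → Type*} [∀ i, Fintype (n i)]
    (Φ : Matrix (∀ i, m i) (∀ i, m i) ℂ →ₗ[ℂ] Matrix (∀ i, n i) (∀ i, n i) ℂ)
    (S : Finset ι) : Prop :=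
  ∀ X, reduce S X = 0 → reduce S (Φ X) = 0

/-- The identity defining semicausality extends linearly from states to all operators, and `Γ` maps
zero to zero. This form, free of `Γ`, is the one carried through the induction. -/
theorem IsSemicausal.isNonsignalling {n : ι → Type*} [∀ i, Fintype (n i)]
    [∀ i, DecidableEq (m i)]
    {Φ : Matrix (∀ i, m i) (∀ i, m i) ℂ →ₗ[ℂ] Matrix (∀ i, n i) (∀ i, n i) ℂ}
    {S : Finset ι} (h : IsSemicausal Φ S) : IsNonsignalling Φ S := by
  obtain ⟨Γ, -, hΓ⟩ := h
  have h1 : reduceLinear S ∘ₗ Φ = Γ ∘ₗ reduceLinear S :=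
    LinearMap.ext_of_isState fun ρ hρ => hΓ ρ hρ
  intro X hX
  have h2 : reduce S (Φ X) = Γ (reduce S X) := LinearMap.congr_fun h1 X
  rw [h2, hX, map_zero]

end Reduce

/-! ### Removing the last party. -/

/-- The parties with number less than `k`. -/
abbrev initialParties (N k : ℕ) : Finset (Fin N) := Finset.univ.filter fun i => (i : ℕ) < k

section Last
variable {N : ℕ} {m : Fin (N + 1) → Type*} [∀ k, Fintype (m k)]

/-- The partial trace over the last party. -/
def traceLast : Matrix (∀ k, m k) (∀ k, m k) ℂ →ₗ[ℂ]
    Matrix (∀ k : Fin N, m k.castSucc) (∀ k : Fin N, m k.castSucc) ℂ where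
  toFun X := Matrix.of fun a b => ∑ z, X (Fin.snoc (α := m) a z) (Fin.snoc (α := m) b z)
  map_add' X Y := by ext; simp [Finset.sum_add_distrib]
  map_smul' c X := by ext; simp [Finset.mul_sum]

theorem traceLast_apply (X : Matrix (∀ k, m k) (∀ k, m k) ℂ)
    (a b : ∀ k : Fin N, m k.castSucc) :
    traceLast X a b = ∑ z, X (Fin.snoc (α := m) a z) (Fin.snoc (α := m) b z) := rfl

theorem sum_pi_snoc (f : (∀ k, m k) → ℂ) :
    ∑ u, f u = ∑ a : (∀ k : Fin N, m k.castSucc), ∑ z, f (Fin.snoc (α := m) a z) := by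
  rw [← Equiv.sum_comp (Fin.snocEquiv m), Fintype.sum_prod_type, Finset.sum_comm]
  rfl

/-- For `k ≤ N` the last party lies outside the cut, so the only constraint on its two labels is
that they agree, which is the trace over it. -/
theorem marginal_traceLast [∀ k, DecidableEq (m k)] {k : ℕ} (hk : k ≤ N)
    (X : Matrix (∀ k, m k) (∀ k, m k) ℂ) (x y : ∀ k, m k) :
    marginal (initialParties (N + 1) k) X x y =
      marginal (initialParties N k) (traceLast X) (Fin.init x) (Fin.init y) := by
  rw [marginal, marginal, sum_pi_snoc]
  refine Finset.sum_congr rfl fun a _ => ?_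
  refine (Finset.sum_congr rfl fun z _ => sum_pi_snoc _).trans ?_
  rw [Finset.sum_comm]
  refine Finset.sum_congr rfl fun b _ => ?_
  simp only [Finset.mem_filter, Finset.mem_univ, true_and, Fin.forall_fin_succ', Fin.snoc_castSucc,
    Fin.snoc_last, Fin.val_castSucc, Fin.val_last, not_lt.mpr hk, false_imp_iff, and_true,
    true_imp_iff, not_false_eq_true, ← and_assoc, Fin.init, traceLast_apply]
  split_ifs with h
  · simp only [eq_true h, true_and]
    simp
  · simp only [eq_false h, false_and, if_false, Finset.sum_const_zero]

theorem reduce_initialParties_eq_zero_iff [∀ k, DecidableEq (m k)] [∀ k, Nonempty (m k)] {k : ℕ}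
    (hk : k ≤ N) (X : Matrix (∀ k, m k) (∀ k, m k) ℂ) :
    reduce (initialParties (N + 1) k) X = 0 ↔ reduce (initialParties N k) (traceLast X) = 0 := by
  simp_rw [reduce_eq_zero_iff, marginal_traceLast hk]
  constructor
  · intro h x y
    have := h (Fin.snoc (α := m) x (Classical.arbitrary _))
      (Fin.snoc (α := m) y (Classical.arbitrary _))
    rwa [Fin.init_snoc, Fin.init_snoc] at this
  · intro h x y
    exact h _ _

theorem reduce_eq_zero_iff_traceLast_eq_zero [∀ k, DecidableEq (m k)] [∀ k, Nonempty (m k)]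
    (X : Matrix (∀ k, m k) (∀ k, m k) ℂ) :
    reduce (initialParties (N + 1) N) X = 0 ↔ traceLast X = 0 := by
  rw [reduce_initialParties_eq_zero_iff le_rfl, reduce_univ_eq_zero_iff (by simp)]

/-- Append to an operator the projector on the basis vector `x₀` of the last party. -/
def appendLast [DecidableEq (m (Fin.last N))] (x₀ : m (Fin.last N)) :
    Matrix (∀ k : Fin N, m k.castSucc) (∀ k : Fin N, m k.castSucc) ℂ →ₗ[ℂ]
      Matrix (∀ k, m k) (∀ k, m k) ℂ where
  toFun X := Matrix.of fun u v => if u (Fin.last N) = x₀ ∧ v (Fin.last N) = x₀ then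
    X (Fin.init u) (Fin.init v) else 0
  map_add' X Y := by ext; simp only [Matrix.of_apply, Matrix.add_apply]; split_ifs <;> simp
  map_smul' c X := by ext; simp

omit [∀ k, Fintype (m k)] in
theorem appendLast_apply [DecidableEq (m (Fin.last N))] (x₀ : m (Fin.last N))
    (X : Matrix (∀ k : Fin N, m k.castSucc) (∀ k : Fin N, m k.castSucc) ℂ) (u v : ∀ k, m k) :
    appendLast x₀ X u v = if u (Fin.last N) = x₀ ∧ v (Fin.last N) = x₀ then
      X (Fin.init u) (Fin.init v) else 0 := rfl

theorem traceLast_appendLast [DecidableEq (m (Fin.last N))] (x₀ : m (Fin.last N))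
    (X : Matrix (∀ k : Fin N, m k.castSucc) (∀ k : Fin N, m k.castSucc) ℂ) :
    traceLast (appendLast x₀ X) = X := by
  ext a b
  simp [traceLast_apply, appendLast_apply]

/-- The channel seen by all parties but the last, when the last one has input `x₀`. -/
def dropLast {n : Fin (N + 1) → Type*} [∀ k, Fintype (n k)] [DecidableEq (m (Fin.last N))]
    (Φ : Matrix (∀ k, m k) (∀ k, m k) ℂ →ₗ[ℂ] Matrix (∀ k, n k) (∀ k, n k) ℂ)
    (x₀ : m (Fin.last N)) :
    Matrix (∀ k : Fin N, m k.castSucc) (∀ k : Fin N, m k.castSucc) ℂ →ₗ[ℂ]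
      Matrix (∀ k : Fin N, n k.castSucc) (∀ k : Fin N, n k.castSucc) ℂ :=
  traceLast ∘ₗ Φ ∘ₗ appendLast x₀

theorem HasKraus.dropLast {n : Fin (N + 1) → Type*} [∀ k, Fintype (n k)] [∀ k, DecidableEq (m k)]
    {Φ : Matrix (∀ k, m k) (∀ k, m k) ℂ →ₗ[ℂ] Matrix (∀ k, n k) (∀ k, n k) ℂ} {t : Type*} [Fintype t] {K : t → Matrix (∀ k, n k) (∀ k, m k) ℂ}
    (h : HasKraus Φ K) (x₀ : m (Fin.last N)) :
    HasKraus (_root_.dropLast Φ x₀) fun p : n (Fin.last N) × t =>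
      Matrix.of fun x a => K p.2 (Fin.snoc (α := n) x p.1) (Fin.snoc (α := m) a x₀) := by
  intro X x y
  change traceLast (Φ (appendLast x₀ X)) x y = _
  rw [traceLast_apply, Fintype.sum_prod_type]
  refine Finset.sum_congr rfl fun z _ => ?_
  rw [h]
  refine Finset.sum_congr rfl fun f _ => ?_
  simp_rw [sum_pi_snoc]
  simp [appendLast_apply, ite_and]

variable {n : Fin (N + 1) → Type*} [∀ k, Fintype (n k)] [∀ k, DecidableEq (m k)]
  [∀ k, Nonempty (m k)] [∀ k, DecidableEq (n k)] [∀ k, Nonempty (n k)]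
  {Φ : Matrix (∀ k, m k) (∀ k, m k) ℂ →ₗ[ℂ] Matrix (∀ k, n k) (∀ k, n k) ℂ}

theorem IsNonsignalling.dropLast {k : ℕ} (hk : k ≤ N)
    (h : IsNonsignalling Φ (initialParties (N + 1) k)) (x₀ : m (Fin.last N)) :
    IsNonsignalling (dropLast Φ x₀) (initialParties N k) := by
  intro X hX
  rw [_root_.dropLast, LinearMap.comp_apply, LinearMap.comp_apply,
    ← reduce_initialParties_eq_zero_iff hk]
  apply h
  rwa [reduce_initialParties_eq_zero_iff hk, traceLast_appendLast]

/-- `X` and `appendLast x₀ (traceLast X)` have the same partial trace over the last party, so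
non-signalling makes their outputs agree there. The choice of `x₀` is thus immaterial. -/
theorem IsNonsignalling.dropLast_traceLast
    (h : IsNonsignalling Φ (initialParties (N + 1) N)) (x₀ : m (Fin.last N))
    (X : Matrix (∀ k, m k) (∀ k, m k) ℂ) :
    _root_.dropLast Φ x₀ (traceLast X) = traceLast (Φ X) := by
  rw [← sub_eq_zero]
  change traceLast (Φ (appendLast x₀ (traceLast X))) - _ = 0
  rw [← map_sub, ← map_sub, ← reduce_eq_zero_iff_traceLast_eq_zero]
  apply h
  rw [reduce_eq_zero_iff_traceLast_eq_zero, map_sub, traceLast_appendLast, sub_self]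

end Last

/-! ### Kraus operators of the dilated map, and evaluation on matrix units. -/

/-- The operator `ρ ↦ S (ρ ⊗ ψ)` obtained by fixing the second tensor factor of the input. -/
noncomputable def feed {a b d : Type*} [Fintype d] (S : Matrix b (a × d) ℂ)
    (ψ : EuclideanSpace ℂ d) : Matrix b a ℂ :=
  Matrix.of fun p i => ∑ g, S p (i, g) * ψ g

/-- The final ancilla label `f` indexes Kraus operators, which reduces the dilation to a statement
about `HasKraus`. -/
theorem traceAncilla_conj_kronecker_ketbra {a b c d : Type*} [Fintype a] [Fintype c] [Fintype d]
    (S : Matrix (b × c) (a × d) ℂ) (ψ : EuclideanSpace ℂ d) (ρ : Matrix a a ℂ) (x y : b) :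
    traceAncilla (S * (ρ ⊗ₖ ketbra ψ) * S.conjTranspose) x y =
      ∑ f, ∑ i, ∑ j, feed S ψ (x, f) i * ρ i j * star (feed S ψ (y, f) j) := by
  simp only [traceAncilla, Matrix.of_apply]
  refine Finset.sum_congr rfl fun f _ => ?_
  simp only [Matrix.mul_apply, Fintype.sum_prod_type, Matrix.kronecker_apply, ketbra,
    Matrix.vecMulVec_apply, Matrix.conjTranspose_apply, feed, Matrix.of_apply, star_sum, star_mul',
    Finset.sum_mul, Finset.mul_sum]
  rw [Finset.sum_congr rfl fun j _ => Finset.sum_comm, Finset.sum_comm]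
  refine Finset.sum_congr rfl fun i _ => Finset.sum_congr rfl fun j _ =>
    Finset.sum_congr rfl fun h _ => Finset.sum_congr rfl fun g _ => ?_
  ring

theorem feed_sequentialOp_succ {N : ℕ} {m n : Fin (N + 1) → Type*}
    [∀ k, Fintype (m k)] [∀ k, DecidableEq (m k)]
    [∀ k, Fintype (n k)] [∀ k, DecidableEq (n k)] (e : ℕ → ℕ)
    (U : ∀ k : Fin (N + 1), Matrix (n k × Fin (e (k + 1))) (m k × Fin (e k)) ℂ)
    (ψ : EuclideanSpace ℂ (Fin (e 0))) (x : ∀ k, n k) (f : Fin (e (N + 1))) (a : ∀ k, m k) :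
    feed (sequentialOp (N + 1) m n e U) ψ (x, f) a =
      ∑ q : m (Fin.last N) × Fin (e N), U (Fin.last N) (x (Fin.last N), f) q *
        if q.1 = a (Fin.last N) then
          feed (sequentialOp N (fun k => m k.castSucc) (fun k => n k.castSucc) e
            fun k => U k.castSucc) ψ (Fin.init x, q.2) (Fin.init a)
        else 0 := by
  simp only [feed, sequentialOp, Matrix.of_apply, Matrix.mul_apply, Matrix.submatrix_apply,
    Matrix.kronecker_apply, id, Matrix.one_apply, Finset.sum_mul]
  rw [Finset.sum_comm, Fintype.sum_prod_type]
  rw [Finset.sum_eq_single (Fin.init x) (by intro p _ hp; simp [hp.symm]) (by simp)]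
  refine Finset.sum_congr rfl fun q _ => ?_
  split_ifs with h
  · simp only [Matrix.kroneckerMap_apply, Matrix.one_apply_eq, one_mul, mul_one, Finset.mul_sum,
      mul_assoc]
  · simp

theorem trace_traceLast {N : ℕ} {m : Fin (N + 1) → Type*} [∀ k, Fintype (m k)]
    (X : Matrix (∀ k, m k) (∀ k, m k) ℂ) : (traceLast X).trace = X.trace := by
  simp [Matrix.trace, sum_pi_snoc, traceLast_apply]

theorem traceLast_single {N : ℕ} {m : Fin (N + 1) → Type*} [∀ k, Fintype (m k)]
    [∀ k, DecidableEq (m k)] (a b : ∀ k, m k) :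
    traceLast (Matrix.single a b (1 : ℂ)) =
      if a (Fin.last N) = b (Fin.last N) then Matrix.single (Fin.init a) (Fin.init b) 1 else 0 := by
  have h : ∀ (a : ∀ k, m k) (p : ∀ k : Fin N, m k.castSucc) z,
      a = Fin.snoc (α := m) p z ↔ Fin.init a = p ∧ a (Fin.last N) = z := by
    intro a p z
    constructor
    · rintro rfl
      simp
    · rintro ⟨rfl, rfl⟩
      simp
  ext p q
  simp only [traceLast_apply, Matrix.single_apply, h]
  by_cases h1 : Fin.init a = p <;> by_cases h2 : Fin.init b = q <;>
    by_cases h3 : a (Fin.last N) = b (Fin.last N) <;>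
    simp [h1, h2, h3, ite_and, eq_comm]

theorem HasKraus.apply_single {t a b : Type*} [Fintype t] [Fintype a] [DecidableEq a]
    {Φ : Matrix a a ℂ →ₗ[ℂ] Matrix b b ℂ} {K : t → Matrix b a ℂ} (h : HasKraus Φ K)
    (i j : a) (x y : b) : Φ (Matrix.single i j 1) x y = ∑ f, K f x i * star (K f y j) := by
  rw [h]
  simp [Matrix.single_apply, ite_and]

/-! ### The induction on the number of parties. -/

/-- The ancilla dimensions are balanced across all parties at once, so the inductive claim must hold
for every balanced `e` above a bound, to be chosen only at the end. -/
theorem exists_sequentialOp_hasKraus : ∀ (N : ℕ) (m n : Fin N → Type*)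
    [∀ k, Fintype (m k)] [∀ k, DecidableEq (m k)] [∀ k, Nonempty (m k)]
    [∀ k, Fintype (n k)] [∀ k, DecidableEq (n k)] [∀ k, Nonempty (n k)]
    (Φ : Matrix (∀ k, m k) (∀ k, m k) ℂ →ₗ[ℂ] Matrix (∀ k, n k) (∀ k, n k) ℂ)
    (t : ℕ) (K : Fin t → Matrix (∀ k, n k) (∀ k, m k) ℂ) (_ : HasKraus Φ K)
    (_ : ∀ X, (Φ X).trace = X.trace)
    (_ : ∀ k < N, IsNonsignalling Φ (initialParties N k)),
    ∃ B : ℕ, ∀ e : ℕ → ℕ,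
      (∀ k : Fin N, Fintype.card (m k) * e k = Fintype.card (n k) * e (k + 1)) →
      (∀ k, B ≤ e k) →
      ∃ (U : ∀ k : Fin N, Matrix (n k × Fin (e (k + 1))) (m k × Fin (e k)) ℂ)
        (ψ : EuclideanSpace ℂ (Fin (e 0))),
        (∀ k, IsUnitaryOp (U k)) ∧ ‖ψ‖ = 1 ∧
        HasKraus Φ fun f : Fin (e N) =>
          Matrix.of fun x a => feed (sequentialOp N m n e U) ψ (x, f) a
  | 0, m, n, _, _, _, _, _, _, Φ, t, K, hK, hTP, hns => by
    -- The bound `1` leaves room for a unit vector; with no parties the operators are scalars, and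
    -- trace preservation makes `Φ` the identity.
    refine ⟨1, fun e _ he => ?_⟩
    refine ⟨fun k => k.elim0, EuclideanSpace.single ⟨0, he 0⟩ 1, fun k => k.elim0, by simp, ?_⟩
    intro X x y
    have h1 := hTP X
    simp only [Matrix.trace, Matrix.diag_apply, Fintype.sum_unique] at h1
    rw [Subsingleton.elim x default, Subsingleton.elim y default, h1]
    simp [feed, sequentialOp, Matrix.one_apply]
  | N + 1, m, n, _, _, _, _, _, _, Φ, t, K, hK, hTP, hns => by
    let x₀ : m (Fin.last N) := Classical.arbitrary _
    have hcut := hns N (Nat.lt_succ_self N)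
    have htr : ∀ X, (dropLast Φ x₀ X).trace = X.trace := by
      intro X
      rw [← traceLast_appendLast x₀ X, hcut.dropLast_traceLast, trace_traceLast, trace_traceLast,
        hTP]
    obtain ⟨K', hK'⟩ := (hK.dropLast x₀).exists_fin le_rfl
    obtain ⟨B, hB⟩ := exists_sequentialOp_hasKraus N (fun k => m k.castSucc)
      (fun k => n k.castSucc) (dropLast Φ x₀) _ K' hK' htr
      fun k hk => (hns k (hk.trans (Nat.lt_succ_self N))).dropLast hk.le x₀
    -- The bound `t` lets the Kraus family of `Φ`, padded by zeros, be indexed by the final ancilla.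
    refine ⟨max B t, fun e hcard he => ?_⟩
    obtain ⟨U', ψ, hU', hψ, hW⟩ := hB e (fun k => hcard k.castSucc)
      fun k => (le_max_left _ _).trans (he k)
    obtain ⟨L, hL⟩ := hK.exists_fin (r := e (N + 1))
      (by simpa using (le_max_right _ _).trans (he (N + 1)))
    let w := feed (sequentialOp N (fun k => m k.castSucc) (fun k => n k.castSucc) e U') ψ
    -- `X` and `Y` are the two dilations reshaped: rows carry the environment, columns the remaining
    -- outputs and all inputs. Left multiplication therefore acts on the environment alone.
    let X : Matrix (m (Fin.last N) × Fin (e N))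
        ((∀ k : Fin N, n k.castSucc) × (∀ k, m k)) ℂ := Matrix.of fun q p =>
      if q.1 = p.2 (Fin.last N) then w (p.1, q.2) (Fin.init p.2) else 0
    let Y : Matrix (n (Fin.last N) × Fin (e (N + 1)))
        ((∀ k : Fin N, n k.castSucc) × (∀ k, m k)) ℂ := Matrix.of fun q p =>
      L q.2 (Fin.snoc (α := n) p.1 q.1) p.2
    -- Both Gram matrices list the entries of `traceLast (Φ (single a b 1))`.
    have hXY : X.conjTranspose * X = Y.conjTranspose * Y := by
      ext ⟨y, b⟩ ⟨x, a⟩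
      have h1 := congrFun (congrFun (hcut.dropLast_traceLast x₀ (Matrix.single a b 1)) x) y
      rw [traceLast_apply, traceLast_single] at h1
      simp_rw [hL.apply_single] at h1
      simp only [Matrix.mul_apply, Matrix.conjTranspose_apply, Fintype.sum_prod_type, X, Y,
        Matrix.of_apply]
      simp_rw [mul_comm (star (L _ _ _))]
      rw [← h1]
      split_ifs with h
      · rw [hW.apply_single]
        rw [Finset.sum_eq_single (a (Fin.last N)) (by intro p _ hp; simp [hp]) (by simp)]
        simp [h, w, mul_comm]
      · rw [map_zero, Matrix.zero_apply]
        refine Finset.sum_eq_zero fun p _ => Finset.sum_eq_zero fun f _ => ?_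
        by_cases hp : p = a (Fin.last N)
        · simp [hp, h]
        · simp [hp]
    obtain ⟨Q, hQ, hQX⟩ := exists_unitary_mul_eq X Y (by simpa using hcard (Fin.last N)) hXY
    let U : ∀ k : Fin (N + 1), Matrix (n k × Fin (e (k + 1))) (m k × Fin (e k)) ℂ :=
      Fin.lastCases Q U'
    have hUlast : U (Fin.last N) = Q := Fin.lastCases_last
    have hUcast : (fun k : Fin N => U k.castSucc) = U' := by
      funext k
      exact Fin.lastCases_castSucc k
    refine ⟨U, ψ, ?_, hψ, ?_⟩
    · intro k
      refine Fin.lastCases ?_ (fun k => ?_) k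
      · rw [hUlast]; exact hQ
      · rw [show U k.castSucc = U' k from congrFun hUcast k]; exact hU' k
    · have hfeed : ∀ x f a, feed (sequentialOp (N + 1) m n e U) ψ (x, f) a = L f x a := by
        intro x f a
        have h1 := congrFun (congrFun hQX (x (Fin.last N), f)) (Fin.init x, a)
        rw [feed_sequentialOp_succ, hUlast, hUcast]
        simpa [Matrix.mul_apply, X, Y] using h1
      intro Z x y
      simp only [Matrix.of_apply, hfeed]
      exact hL Z x y

/-! ### Ancilla dimensions and the conclusion. -/

theorem exists_balanced_sequence {N : ℕ} (p q : Fin N → ℕ) (hp : ∀ i, 0 < p i)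
    (hq : ∀ i, 0 < q i) (B : ℕ) :
    ∃ e : ℕ → ℕ, (∀ k : Fin N, p k * e k = q k * e (k + 1)) ∧ ∀ k, B ≤ e k := by
  let c : ℕ → Fin N → ℕ := fun k i => if (i : ℕ) < k then p i else q i
  -- Going from `k` to `k + 1` replaces the single factor `q k` by `p k`.
  refine ⟨fun k => (B + 1) * ∏ i, c k i, fun k => ?_, fun k => ?_⟩
  · have hprod : ∀ l, ∏ i, c l i = c l k * ∏ i ∈ Finset.univ.erase k, c l i := fun l =>
      (Finset.mul_prod_erase _ _ (Finset.mem_univ k)).symm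
    have hrest : ∏ i ∈ Finset.univ.erase k, c (k + 1) i = ∏ i ∈ Finset.univ.erase k, c k i := by
      refine Finset.prod_congr rfl fun i hi => ?_
      have hik : (i : ℕ) ≠ k := fun h => Finset.ne_of_mem_erase hi (Fin.ext h)
      have : (i : ℕ) < k + 1 ↔ (i : ℕ) < k := by omega
      simp only [c, this]
    beta_reduce
    rw [hprod, hprod, hrest]
    simp only [c, lt_irrefl, if_false, Nat.lt_succ_self, if_true]
    ring
  · have : 0 < ∏ i, c k i := by
      refine Finset.prod_pos fun i _ => ?_
      simp only [c]
      split_ifs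
      exacts [hp i, hq i]
    calc B ≤ (B + 1) * 1 := by omega
      _ ≤ (B + 1) * ∏ i, c k i := Nat.mul_le_mul_left _ this

theorem IsOrderedSemicausal.isNonsignalling {N : ℕ} {m n : Fin N → Type*}
    [∀ k, Fintype (m k)] [∀ k, DecidableEq (m k)] [∀ k, Nonempty (m k)]
    [∀ k, Fintype (n k)] [∀ k, DecidableEq (n k)] [∀ k, Nonempty (n k)]
    {Φ : Matrix (∀ k, m k) (∀ k, m k) ℂ →ₗ[ℂ] Matrix (∀ k, n k) (∀ k, n k) ℂ}
    (hTP : ∀ X, (Φ X).trace = X.trace) (h : IsOrderedSemicausal Φ) :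
    ∀ k < N, IsNonsignalling Φ (initialParties N k) := by
  intro k hk
  rcases Nat.eq_zero_or_pos k with rfl | hpos
  -- The empty cut is not among the semicausality assumptions; there non-signalling follows from
  -- trace preservation. It is the cut used when a single party remains.
  · have h0 : initialParties N 0 = ∅ := by simp
    rw [h0]
    intro X hX
    rw [reduce_empty_eq_zero_iff] at hX ⊢
    rw [hTP, hX]
  · exact (h k hpos hk).isNonsignalling

/-- A matrix unit of trace one cannot be sent to an empty matrix. This makes the output dimensions
positive, as the balancing requires. -/
theorem IsChannel.nonempty {a b : Type*} [Fintype a] [DecidableEq a] [Fintype b] [Nonempty a]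
    {Φ : Matrix a a ℂ →ₗ[ℂ] Matrix b b ℂ} (h : IsChannel Φ) : Nonempty b := by
  by_contra hempty
  rw [not_nonempty_iff] at hempty
  have i : a := Classical.arbitrary _
  have h1 := h.2 (Matrix.single i i 1)
  simp [Matrix.trace] at h1

theorem mainTheorem9 {N : ℕ} (m n : Fin N → Type*)
    [∀ k, Fintype (m k)] [∀ k, DecidableEq (m k)] [∀ k, Nonempty (m k)]
    [∀ k, Fintype (n k)] [∀ k, DecidableEq (n k)]
    (Λ : Matrix (∀ k, m k) (∀ k, m k) ℂ →ₗ[ℂ] Matrix (∀ k, n k) (∀ k, n k) ℂ)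
    (hΛ : IsChannel Λ) (hsc : IsOrderedSemicausal Λ) :
    ∃ (e : ℕ → ℕ)
      (U : ∀ k : Fin N, Matrix (n k × Fin (e (k + 1))) (m k × Fin (e k)) ℂ)
      (ψ : EuclideanSpace ℂ (Fin (e 0))),
      (∀ k, IsUnitaryOp (U k)) ∧ ‖ψ‖ = 1 ∧
      ∀ ρ : Matrix (∀ k, m k) (∀ k, m k) ℂ,
        Λ ρ = traceAncilla (sequentialOp N m n e U * (ρ ⊗ₖ ketbra ψ) *
          (sequentialOp N m n e U).conjTranspose) := by
  have hn : ∀ k, Nonempty (n k) := fun k => hΛ.nonempty.map fun x => x k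
  obtain ⟨K, hK⟩ := hΛ.1.exists_hasKraus
  obtain ⟨K', hK'⟩ := hK.exists_fin le_rfl
  obtain ⟨B, hB⟩ := exists_sequentialOp_hasKraus N m n Λ _ K' hK' hΛ.2 (hsc.isNonsignalling hΛ.2)
  obtain ⟨e, he, hBe⟩ := exists_balanced_sequence (fun k => Fintype.card (m k))
    (fun k => Fintype.card (n k)) (fun _ => Fintype.card_pos) (fun _ => Fintype.card_pos) B
  obtain ⟨U, ψ, hU, hψ, h⟩ := hB e he hBe
  refine ⟨e, U, ψ, hU, hψ, fun ρ => ?_⟩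
  ext x y
  rw [traceAncilla_conj_kronecker_ketbra, h]
  rfl
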